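/- Let $F(x)=\mu((-\infty,x])$ be the distribution function of a Borel probability measure $\mu$ on $\mathbb R$, let $\bar F=1-F$, let $\omega(F)=\sup\operatorname{supp}\mu\in(-\infty,\infty]$, and let $\alpha>0$. Put $F^{\boxdot n}=F\boxdot\cdots\boxdot F$ ($n$ times), where $F\boxdot G=\max(0,F+G-1)$; thus $F^{\boxdot n}=\max(0,nF-(n-1))$. Let $B_\alpha$ be the Beta distribution function, $B_\alpha(x)=0$ for $x<-1$, $B_\alpha(x)=1-|x|^\alpha$ for $-1\le x\le 0$, $B_\alpha(x)=1$ for $x>0$, and let $\Psi_\alpha$ be the Weibull distribution function, $\Psi_\alpha(x)=\exp(-(-x)^\alpha)$ for $x<0$, $\Psi_\alpha(x)=1$ for $x\ge 0$. Then the following are equivalent. (i) $F$ is in the free max-domain of attraction of $B_\alpha$: there are $a_n>0$ and $b_n\in\mathbb R$ such that $F^{\boxdot n}(a_nx+b_n)\to B_\alpha(x)$ as $n\to\infty$ at every continuity point $x$ of $B_\alpha$. (ii) $F$ is in the classical max-domain of attraction of $\Psi_\alpha$: there are $a_n>0$ and $b_n\in\mathbb R$ such that $F(a_nx+b_n)^n\to\Psi_\alpha(x)$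 as $n\to\infty$ at every continuity point $x$ of $\Psi_\alpha$. (iii) $\omega(F)<\infty$ and $u\mapsto\bar F(\omega(F)-u)$ is regularly varying of exponent $\alpha$ at $0$, that is, $$\lim_{h\downarrow 0}\frac{\bar F(\omega(F)-xh)}{\bar F(\omega(F)-h)}=x^\alpha\qquad\text{for every }x>0.$$ Moreover, if these conditions hold, then with $u_n=\inf\{t\in\mathbb R:\bar F(t)<1/n\}$ one has $\omega(F)-u_n>0$ for all $n\ge 2$, and the convergences in (i) and in (ii) both hold with the normalizing constants $a_n=\omega(F)-u_n$ and $b_n=\omega(F)$. -/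

import Mathlib

open MeasureTheory ProbabilityTheory Filter Topology

noncomputable section

namespace FreeExtreme

/-- The upper extremal free convolution of two distribution functions,
`(F ⊡ G)(t) = max (0, F(t) + G(t) - 1)`. -/
def freeMax (F G : ℝ → ℝ) : ℝ → ℝ := fun t => max 0 (F t + G t - 1)

/-- The `n`-fold iterate `F ⊡ ⋯ ⊡ F` (the empty iterate is the constant `1`, which is neutral
for `⊡`). -/
def freeMaxPow (F : ℝ → ℝ) : ℕ → ℝ → ℝ
  | 0 => fun _ => 1
  | n + 1 => freeMax (freeMaxPow F n) F

/-- The closed form `F^{⊡ n} = (n F - (n - 1))₊`. -/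
theorem freeMaxPow_apply (F : ℝ → ℝ) (hF : ∀ t, F t ≤ 1) (n : ℕ) (t : ℝ) :
    freeMaxPow F n t = max 0 (n * F t - (n - 1)) := by
  induction n with
  | zero => simp [freeMaxPow]
  | succ n ih =>
    have h := hF t
    simp only [freeMaxPow, freeMax, ih]
    push_cast
    rcases le_total (n * F t - (n - 1)) 0 with h1 | h1
    · rw [max_eq_left h1, max_eq_left (by linarith), max_eq_left (by linarith)]
    · rw [max_eq_right h1]
      congr 1
      ring

/-- Weak convergence of (distribution) functions: convergence at every continuity point of the
limit. -/
def WeakLimit (H : ℕ → ℝ → ℝ) (G : ℝ → ℝ) : Prop :=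
  ∀ x : ℝ, ContinuousAt G x → Tendsto (fun n => H n x) atTop (𝓝 (G x))

/-- `F^{⊡ n}(a_n x + b_n)` converges weakly to `G(x)`. -/
def FreeMaxLimit (F G : ℝ → ℝ) (a b : ℕ → ℝ) : Prop :=
  WeakLimit (fun n x => freeMaxPow F n (a n * x + b n)) G

/-- `F(a_n x + b_n)^n` converges weakly to `G(x)`. -/
def ClassicalMaxLimit (F G : ℝ → ℝ) (a b : ℕ → ℝ) : Prop :=
  WeakLimit (fun n x => F (a n * x + b n) ^ n) G

/-- `F` is in the free max-domain of attraction of `G`. -/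
def InFreeMaxDomain (F G : ℝ → ℝ) : Prop :=
  ∃ a b : ℕ → ℝ, (∀ n, 0 < a n) ∧ FreeMaxLimit F G a b

/-- `F` is in the classical max-domain of attraction of `G`. -/
def InClassicalMaxDomain (F G : ℝ → ℝ) : Prop :=
  ∃ a b : ℕ → ℝ, (∀ n, 0 < a n) ∧ ClassicalMaxLimit F G a b

/-- The distribution function of the Beta law: `1 - |x|^α` for `-1 ≤ x ≤ 0`. -/
def betaLaw (α : ℝ) (x : ℝ) : ℝ :=
  if x < -1 then 0 else if x ≤ 0 then 1 - |x| ^ α else 1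

/-- The Weibull (reversed Weibull) extreme value distribution function `Ψ_α`. -/
def weibullLaw (α : ℝ) (x : ℝ) : ℝ :=
  if x < 0 then Real.exp (-(-x) ^ α) else 1

/-- The tail `1 - F`. -/
def tail (F : ℝ → ℝ) (x : ℝ) : ℝ := 1 - F x

/-- The supremum in `[-∞, ∞]` of the support of `μ`. -/
def upperEndpoint (μ : Measure ℝ) : EReal := sSup (Real.toEReal '' μ.support)

/-- `f` is regularly varying of exponent `α` at `0` (from the right). -/
def RegVaryingAtZero (f : ℝ → ℝ) (α : ℝ) : Prop :=
  ∀ x : ℝ, 0 < x → Tendsto (fun h => f (x * h) / f h) (𝓝[>] 0) (𝓝 (x ^ α))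

/-- `u_n = inf {t : 1 - F(t) < 1 / n}`. For a distribution function and `n ≥ 2` the set is
nonempty and bounded below, so that this is a genuine infimum. -/
def tailQuantile (F : ℝ → ℝ) (n : ℕ) : ℝ := sInf {t : ℝ | tail F t < 1 / (n : ℝ)}

end FreeExtreme

end

open FreeExtreme

/-!
Both domains of attraction are conditions on the tail `T = 1 - F` alone: since
`F^{⊡ n} = (1 - n T)₊` and `F ^ n = (1 - T) ^ n`, free attraction to the Beta law and classical
attraction to the Weibull law each imply
`n T(b_n - a_n c) → c ^ α` for `0 < c < 1` (`HasPowerTail`), and each follows from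
`n T(ω - a_n y) → y ^ α` for all `y > 0`.

From `HasPowerTail` one recovers regular variation as follows. As `c ↦ c ^ α` is strictly
increasing, `n T(b_n - a_n y_n) → c ^ α` is equivalent to `y_n → c`, along any sequence of indices
(`HasPowerTail.comp`, `HasPowerTail.tendsto_of_comp`). Comparing the indices `n` and `2n` gives
`a_{2n} / a_n → (1/2) ^ (1/α) < 1` and `(b_{2n} - b_n) / a_n → 0`; summing a geometric series along
`n, 2n, 4n, …` shows that `T` vanishes beyond `b_n + o(a_n)` and not before `b_n - o(a_n)`, so that
`ω` is finite and `b_n` may be replaced by `ω` (`HasPowerTail.exists_endpoint`). Taking the index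
`⌊c ^ α / T(ω - h)⌋` as `h ↓ 0` then gives regular variation (`HasPowerTail.regVarying`).

Conversely, regular variation forces `T(ω - h) → 0`, whence `u_n < ω`, and the quantile satisfies
`n T(ω - y (ω - u_n)) < 1` for `y < 1` and `≥ 1` for `y > 1`, so that `n T(u_n) → 1`
(`tendsto_mul_tail_quantile`).
-/

namespace FreeExtreme

/-! ### Power behaviour of tails along normalizing sequences -/

/-- The tail `T`, normalized by `a` and `b`, behaves like `c ^ α` to the left of `b`. Only
`0 < c < 1` is required, because convergence to the Beta law gives no information for `c > 1`. -/
def HasPowerTail (T : ℝ → ℝ) (α : ℝ) (a b : ℕ → ℝ) : Prop :=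
  ∀ c : ℝ, 0 < c → c < 1 → Tendsto (fun n : ℕ => n * T (b n - a n * c)) atTop (𝓝 (c ^ α))

section PowerTail

variable {T : ℝ → ℝ} {α : ℝ} {a b : ℕ → ℝ}

theorem mul_tail_mono (hT : Antitone T) (ha : ∀ n, 0 < a n) (n : ℕ) {u v : ℝ} (huv : u ≤ v) :
    (n : ℝ) * T (b n - a n * u) ≤ n * T (b n - a n * v) := by
  refine mul_le_mul_of_nonneg_left (hT ?_) (Nat.cast_nonneg _)
  linarith [mul_le_mul_of_nonneg_left huv (ha n).le]

theorem HasPowerTail.tendsto_zero (H : HasPowerTail T α a b) :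
    Tendsto (fun n : ℕ => T (b n - a n * (1 / 2))) atTop (𝓝 0) := by
  have := (H (1 / 2) (by norm_num) (by norm_num)).mul (tendsto_inv_atTop_nhds_zero_nat (𝕜 := ℝ))
  rw [mul_zero] at this
  refine this.congr' ?_
  filter_upwards [eventually_gt_atTop 0] with n hn
  have : (n : ℝ) ≠ 0 := by positivity
  field_simp

theorem HasPowerTail.comp (hT : Antitone T) (ha : ∀ n, 0 < a n)
    (H : HasPowerTail T α a b) {ι : Type*} {l : Filter ι} {N : ι → ℕ} (hN : Tendsto N l atTop)
    {y : ι → ℝ} {c : ℝ} (hc : 0 < c) (hc1 : c < 1) (hy : Tendsto y l (𝓝 c)) :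
    Tendsto (fun i => (N i : ℝ) * T (b (N i) - a (N i) * y i)) l (𝓝 (c ^ α)) := by
  have hcont : Tendsto (fun x : ℝ => x ^ α) (𝓝 c) (𝓝 (c ^ α)) :=
    (Real.continuousAt_rpow_const c α (Or.inl hc.ne')).tendsto
  refine tendsto_order.2 ⟨fun L hL => ?_, fun L hL => ?_⟩
  · have h1 : ∀ᶠ x in 𝓝[<] c, L < x ^ α ∧ 0 < x ∧ x < c := by
      filter_upwards [nhdsWithin_le_nhds (hcont.eventually (lt_mem_nhds hL)),
        nhdsWithin_le_nhds (lt_mem_nhds hc), self_mem_nhdsWithin] with x h h' h'' using ⟨h, h', h''⟩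
    obtain ⟨c', h2, h3, h4⟩ := h1.exists
    filter_upwards [hy.eventually (lt_mem_nhds h4),
      ((H c' h3 (h4.trans hc1)).comp hN).eventually (lt_mem_nhds h2)] with i hi hi'
    exact lt_of_lt_of_le hi' (mul_tail_mono hT ha _ hi.le)
  · have h1 : ∀ᶠ x in 𝓝[>] c, x ^ α < L ∧ x < 1 ∧ c < x := by
      filter_upwards [nhdsWithin_le_nhds (hcont.eventually (gt_mem_nhds hL)),
        nhdsWithin_le_nhds (gt_mem_nhds hc1), self_mem_nhdsWithin] with x h h' h'' using ⟨h, h', h''⟩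
    obtain ⟨c', h2, h3, h4⟩ := h1.exists
    filter_upwards [hy.eventually (gt_mem_nhds h4),
      ((H c' (hc.trans h4) h3).comp hN).eventually (gt_mem_nhds h2)] with i hi hi'
    exact lt_of_le_of_lt (mul_tail_mono hT ha _ hi.le) hi'

/-- Inversion: the normalized tail determines the position asymptotically. -/
theorem HasPowerTail.tendsto_of_comp (hT : Antitone T) (hα : 0 < α) (ha : ∀ n, 0 < a n)
    (H : HasPowerTail T α a b) {ι : Type*} {l : Filter ι} {N : ι → ℕ} (hN : Tendsto N l atTop)
    {y : ι → ℝ} {c : ℝ} (hc : 0 < c) (hc1 : c < 1)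
    (hy : Tendsto (fun i => (N i : ℝ) * T (b (N i) - a (N i) * y i)) l (𝓝 (c ^ α))) :
    Tendsto y l (𝓝 c) := by
  refine tendsto_order.2 ⟨fun L hL => ?_, fun L hL => ?_⟩
  · obtain ⟨c', h1, h2⟩ := exists_between (max_lt hL hc)
    have h3 : 0 < c' := (le_max_right _ _).trans_lt h1
    filter_upwards [((H c' h3 (h2.trans hc1)).comp hN).eventually_lt hy
      (Real.rpow_lt_rpow h3.le h2 hα)] with i hi
    by_contra hcon
    have h4 : y i ≤ c' := (not_lt.1 hcon).trans ((le_max_left _ _).trans h1.le)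
    exact absurd (mul_tail_mono hT ha _ h4) (not_le.2 hi)
  · obtain ⟨c', h1, h2⟩ := exists_between (lt_min hL hc1)
    have h3 : 0 < c' := hc.trans h1
    filter_upwards [hy.eventually_lt ((H c' h3 (h2.trans_le (min_le_right _ _))).comp hN)
      (Real.rpow_lt_rpow hc.le h1 hα)] with i hi
    by_contra hcon
    have h4 : c' ≤ y i := (h2.le.trans (min_le_left _ _)).trans (not_lt.1 hcon)
    exact absurd (mul_tail_mono hT ha _ h4) (not_le.2 hi)

/-- Convergence of types for the indices `n` and `2 n`. -/
theorem HasPowerTail.doubling (hT : Antitone T) (hα : 0 < α) (ha : ∀ n, 0 < a n)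
    (H : HasPowerTail T α a b) :
    Tendsto (fun n => a (2 * n) / a n) atTop (𝓝 ((1 / 2 : ℝ) ^ α⁻¹)) ∧
      Tendsto (fun n => (b (2 * n) - b n) / a n) atTop (𝓝 0) := by
  set r : ℝ := (1 / 2 : ℝ) ^ α⁻¹ with hr
  have hr0 : 0 < r := by positivity
  have hr1 : r < 1 := Real.rpow_lt_one (by norm_num) (by norm_num) (inv_pos.2 hα)
  have hrα : r ^ α = 1 / 2 := Real.rpow_inv_rpow (by norm_num) hα.ne'
  have h2 : Tendsto (fun n : ℕ => 2 * n) atTop atTop :=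
    tendsto_id.const_mul_atTop' (by norm_num)
  have key : ∀ c : ℝ, 0 < c → c < 1 →
      Tendsto (fun n => (a (2 * n) / a n) * c - (b (2 * n) - b n) / a n) atTop (𝓝 (r * c)) := by
    intro c hc hc1
    refine H.tendsto_of_comp hT hα ha tendsto_id (by positivity)
      (mul_lt_one_of_nonneg_of_lt_one_left hr0.le hr1 hc1.le) ?_
    rw [Real.mul_rpow hr0.le hc.le, hrα]
    refine (((H c hc hc1).comp h2).const_mul (1 / 2 : ℝ)).congr fun n => ?_
    have hn := (ha n).ne'
    have : b n - a n * ((a (2 * n) / a n) * c - (b (2 * n) - b n) / a n)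
        = b (2 * n) - a (2 * n) * c := by
      field_simp
      ring
    simp only [Function.comp_apply, id_eq, this]
    push_cast
    ring
  have k1 := key (1 / 2) (by norm_num) (by norm_num)
  have k2 := key (1 / 4) (by norm_num) (by norm_num)
  constructor
  · convert (k1.sub k2).const_mul 4 using 2 <;> ring
  · convert (k1.sub (k2.const_mul 2)) using 2 <;> ring

/-- The right endpoint is finite, and it is within `o (a n)` of `b n`. -/
theorem HasPowerTail.exists_endpoint (hT : Antitone T) (hT0 : ∀ t, 0 ≤ T t) (hα : 0 < α)
    (ha : ∀ n, 0 < a n) (H : HasPowerTail T α a b) (w : EReal)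
    (hw : ∀ t : ℝ, w ≤ t ↔ T t = 0) :
    w < ⊤ ∧ w ≠ ⊥ ∧ Tendsto (fun n => (w.toReal - b n) / a n) atTop (𝓝 0) := by
  obtain ⟨hd1, hd2⟩ := H.doubling hT hα ha
  have hr1 : (1 / 2 : ℝ) ^ α⁻¹ < 1 :=
    Real.rpow_lt_one (by norm_num) (by norm_num) (inv_pos.2 hα)
  obtain ⟨ρ, hρr, hρ1⟩ := exists_between hr1
  have hρ0 : 0 < ρ := lt_trans (by positivity) hρr
  have hmid := H (1 / 2) (by norm_num) (by norm_num)
  -- `T (b n) → 0`, because `n * T (b n - a n / 2)` converges.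
  have hTb : Tendsto (fun n => T (b n)) atTop (𝓝 0) := by
    refine squeeze_zero (fun n => hT0 _) (fun n => hT ?_) H.tendsto_zero
    linarith [ha n]
  have hpos : ∀ᶠ n : ℕ in atTop, 0 < T (b n - a n * (1 / 2)) := by
    have h0 : (0 : ℝ) < (1 / 2 : ℝ) ^ α := by positivity
    filter_upwards [hmid.eventually (lt_mem_nhds h0)] with n hn
    exact pos_of_mul_pos_right hn (Nat.cast_nonneg n)
  have main : ∀ ε > 0, ∀ᶠ n in atTop,
      w ≤ ((b n + ε * a n : ℝ) : EReal) ∧ ((b n - ε * a n : ℝ) : EReal) ≤ w := by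
    intro ε hε
    have hε' : 0 < ε * (1 - ρ) := mul_pos hε (by linarith)
    obtain ⟨M, hM⟩ := eventually_atTop.1 ((hd1.eventually (gt_mem_nhds hρr)).and
      (hd2.eventually (Metric.ball_mem_nhds (0 : ℝ) hε')))
    filter_upwards [eventually_ge_atTop M, eventually_ge_atTop 1] with n hn hn1
    have step : ∀ m, M ≤ m → a (2 * m) ≤ ρ * a m ∧ |b (2 * m) - b m| ≤ ε * (1 - ρ) * a m := by
      intro m hm
      obtain ⟨h1, h2⟩ := hM m hm
      rw [dist_zero_right, Real.norm_eq_abs, abs_div, abs_of_pos (ha m)] at h2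
      exact ⟨((div_lt_iff₀ (ha m)).1 h1).le, ((div_lt_iff₀ (ha m)).1 h2).le⟩
    -- Summing the geometric series along `n, 2 n, 4 n, …`.
    have iter : ∀ k : ℕ, a (2 ^ k * n) ≤ ρ ^ k * a n ∧
        |b (2 ^ k * n) - b n| ≤ ε * (1 - ρ ^ k) * a n := by
      intro k
      induction k with
      | zero => simp
      | succ k ih =>
        have hk : M ≤ 2 ^ k * n := hn.trans (Nat.le_mul_of_pos_left n (by positivity))
        obtain ⟨s1, s2⟩ := step _ hk
        have e : 2 ^ (k + 1) * n = 2 * (2 ^ k * n) := by ring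
        rw [e]
        constructor
        · calc _ ≤ ρ * a (2 ^ k * n) := s1
            _ ≤ ρ * (ρ ^ k * a n) := by gcongr; exact ih.1
            _ = _ := by ring
        · calc _ ≤ |b (2 * (2 ^ k * n)) - b (2 ^ k * n)| + |b (2 ^ k * n) - b n| :=
                abs_sub_le _ _ _
            _ ≤ ε * (1 - ρ) * (ρ ^ k * a n) + ε * (1 - ρ ^ k) * a n :=
                add_le_add (s2.trans (mul_le_mul_of_nonneg_left ih.1 hε'.le)) ih.2
            _ = _ := by ring
    have hbk : ∀ k : ℕ, |b (2 ^ k * n) - b n| ≤ ε * a n := fun k => (iter k).2.trans <| by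
      have := mul_pos (mul_pos hε (pow_pos hρ0 k)) (ha n)
      linarith
    have hsub : Tendsto (fun k : ℕ => 2 ^ k * n) atTop atTop :=
      (tendsto_pow_atTop_atTop_of_one_lt (by norm_num : 1 < 2)).atTop_mul_const' hn1
    constructor
    · rw [hw]
      refine le_antisymm (ge_of_tendsto' (hTb.comp hsub) fun k => hT ?_) (hT0 _)
      linarith [(abs_le.1 (hbk k)).2]
    · have hlim : Tendsto (fun k : ℕ => ((b n - ε * a n - ρ ^ k * a n * (1 / 2) : ℝ) : EReal))
          atTop (𝓝 ((b n - ε * a n : ℝ) : EReal)) := by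
        refine (continuous_coe_real_ereal.tendsto _).comp ?_
        have := (((tendsto_pow_atTop_nhds_zero_of_lt_one hρ0.le hρ1).mul_const (a n)).mul_const
          (1 / 2)).const_sub (b n - ε * a n)
        simpa using this
      refine le_of_tendsto hlim ?_
      filter_upwards [hsub.eventually hpos] with k hk
      have h1 : ((b (2 ^ k * n) - a (2 ^ k * n) * (1 / 2) : ℝ) : EReal) ≤ w := by
        by_contra hcon
        exact hk.ne' ((hw _).1 (not_le.1 hcon).le)
      refine le_trans (EReal.coe_le_coe_iff.2 ?_) h1
      linarith [(abs_le.1 (hbk k)).1, (iter k).1]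
  obtain ⟨n, hn⟩ := (main 1 one_pos).exists
  have htop : w < ⊤ := hn.1.trans_lt (EReal.coe_lt_top _)
  have hbot : w ≠ ⊥ := ((EReal.bot_lt_coe _).trans_le hn.2).ne'
  refine ⟨htop, hbot, Metric.tendsto_nhds.2 fun ε hε => ?_⟩
  filter_upwards [main (ε / 2) (half_pos hε)] with n hn
  rw [← EReal.coe_toReal htop.ne hbot, EReal.coe_le_coe_iff, EReal.coe_le_coe_iff] at hn
  rw [dist_zero_right, Real.norm_eq_abs, abs_div, abs_of_pos (ha n), div_lt_iff₀ (ha n)]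
  have := mul_pos hε (ha n)
  rw [abs_lt]
  constructor <;> linarith [hn.1, hn.2]

/-- Regular variation at `w` of a tail that has power behaviour when centred at `w`. -/
theorem HasPowerTail.regVarying (hT : Antitone T) (hα : 0 < α) (ha : ∀ n, 0 < a n) {w : ℝ}
    (hpos : ∀ t < w, 0 < T t) (H : HasPowerTail T α a (fun _ => w)) :
    RegVaryingAtZero (fun u => T (w - u)) α := by
  intro x hx
  have hT0 : Tendsto (fun h => T (w - h)) (𝓝[>] 0) (𝓝 0) := by
    refine tendsto_order.2 ⟨fun L hL => ?_, fun L hL => ?_⟩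
    · filter_upwards [self_mem_nhdsWithin] with h hh
      exact hL.trans (hpos _ (by linarith [Set.mem_Ioi.1 hh]))
    · obtain ⟨n, hn⟩ := (H.tendsto_zero.eventually (gt_mem_nhds hL)).exists
      have h2 : 0 < a n * (1 / 2) := by linarith [ha n]
      filter_upwards [nhdsWithin_le_nhds (gt_mem_nhds h2)] with h hh
      exact (hT (by linarith)).trans_lt hn
  have hTpos : ∀ᶠ h in 𝓝[>] (0 : ℝ), 0 < T (w - h) := by
    filter_upwards [self_mem_nhdsWithin] with h hh
    exact hpos _ (by linarith [Set.mem_Ioi.1 hh])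
  have hinv : Tendsto (fun h => (T (w - h))⁻¹) (𝓝[>] 0) atTop :=
    tendsto_inv_nhdsGT_zero.comp (tendsto_nhdsWithin_iff.2 ⟨hT0, hTpos⟩)
  -- `c` is chosen such that both `c` and `x * c` lie in `(0, 1)`.
  set c : ℝ := 1 / (2 + x) with hc
  have hc0 : 0 < c := by positivity
  have hc1 : c < 1 := by rw [hc, div_lt_one (by positivity)]; linarith
  have hxc : x * c < 1 := by
    rw [hc, mul_one_div, div_lt_one (by positivity)]; linarith
  have hcα : 0 < c ^ α := by positivity
  set N : ℝ → ℕ := fun h => ⌊c ^ α * (T (w - h))⁻¹⌋₊ with hNdef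
  have hN : Tendsto N (𝓝[>] 0) atTop :=
    tendsto_nat_floor_atTop.comp (hinv.const_mul_atTop hcα)
  have hNT : Tendsto (fun h => (N h : ℝ) * T (w - h)) (𝓝[>] 0) (𝓝 (c ^ α)) := by
    refine ((tendsto_nat_floor_mul_div_atTop hcα.le).comp hinv).congr fun h => ?_
    simp [hNdef]
  have hy : Tendsto (fun h => h / a (N h)) (𝓝[>] 0) (𝓝 c) := by
    refine H.tendsto_of_comp hT hα ha hN hc0 hc1 (hNT.congr fun h => ?_)
    rw [mul_div_cancel₀ _ (ha _).ne']
  have hxy := H.comp hT ha hN (by positivity) hxc (hy.const_mul x)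
  have hfin := hxy.div hNT hcα.ne'
  rw [Real.mul_rpow hx.le hc0.le, mul_div_cancel_right₀ _ hcα.ne'] at hfin
  refine hfin.congr' ?_
  filter_upwards [hN.eventually (eventually_gt_atTop 0)] with h hh
  have h1 : a (N h) * (x * (h / a (N h))) = x * h := by
    have := (ha (N h)).ne'
    field_simp
  have h2 : (N h : ℝ) ≠ 0 := by positivity
  simp only [Pi.div_apply, h1]
  rw [mul_div_mul_left _ _ h2]

/-- The endpoint `w` can serve as centring, whence regular variation at `w`. -/
theorem HasPowerTail.endpoint_regVarying (hT : Antitone T) (hT0 : ∀ t, 0 ≤ T t) (hα : 0 < α)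
    (ha : ∀ n, 0 < a n) (H : HasPowerTail T α a b) (w : EReal)
    (hw : ∀ t : ℝ, w ≤ t ↔ T t = 0) :
    w < ⊤ ∧ RegVaryingAtZero (fun u => T (w.toReal - u)) α := by
  obtain ⟨htop, hbot, hlim⟩ := H.exists_endpoint hT hT0 hα ha w hw
  refine ⟨htop, HasPowerTail.regVarying (a := a) hT hα ha (fun t ht => ?_) fun c hc hc1 => ?_⟩
  · refine lt_of_le_of_ne (hT0 t) fun h0 => ?_
    have := (hw t).2 h0.symm
    rw [← EReal.coe_toReal htop.ne hbot, EReal.coe_le_coe_iff] at this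
    exact absurd ht (not_lt.2 this)
  · have h1 : Tendsto (fun n => c - (w.toReal - b n) / a n) atTop (𝓝 c) := by
      simpa using hlim.const_sub c
    refine (H.comp hT ha tendsto_id hc hc1 h1).congr fun n => ?_
    have := (ha n).ne'
    simp only [id_eq]
    congr 2
    field_simp
    ring

end PowerTail

/-! ### Regular variation and the tail quantile -/

section Quantile

variable {T : ℝ → ℝ} {α w : ℝ}

theorem RegVaryingAtZero.tendsto_zero (hα : 0 < α) (hT : Antitone T)
    (hR : RegVaryingAtZero (fun u => T (w - u)) α) :
    Tendsto (fun h => T (w - h)) (𝓝[>] 0) (𝓝 0) := by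
  have hmono : Monotone fun h => T (w - h) := fun u v huv => hT (by linarith)
  have hL := hmono.tendsto_nhdsGT 0
  set L := sInf ((fun h => T (w - h)) '' Set.Ioi 0)
  -- A nonzero limit `L` would give `2 ^ α = L / L = 1`.
  by_cases hL0 : L = 0
  · rwa [hL0] at hL
  exfalso
  have h2 : Tendsto (fun h : ℝ => 2 * h) (𝓝[>] 0) (𝓝[>] 0) := by
    refine tendsto_nhdsWithin_iff.2 ⟨?_, ?_⟩
    · have : Tendsto (fun h : ℝ => 2 * h) (𝓝 0) (𝓝 (2 * 0)) := (continuous_const_mul 2).tendsto 0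
      rw [mul_zero] at this
      exact this.mono_left nhdsWithin_le_nhds
    · filter_upwards [self_mem_nhdsWithin] with h hh
      exact mul_pos two_pos (Set.mem_Ioi.1 hh)
  have h3 := (hL.comp h2).div hL hL0
  rw [div_self hL0] at h3
  have h4 := tendsto_nhds_unique h3 (hR 2 two_pos)
  exact (Real.one_lt_rpow one_lt_two hα).ne h4

variable {u : ℕ → ℝ}

/-- The sequence `u` is any one squeezed between `{T ≥ 1 / n}` and `{T < 1 / n}`, as the tail
quantiles are; no continuity of `T` at `u n` is needed. -/
theorem tendsto_mul_tail_quantile (hpos : ∀ t < w, 0 < T t)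
    (hR : RegVaryingAtZero (fun u => T (w - u)) α) (hu : ∀ n, 2 ≤ n → u n < w)
    (hlt : ∀ n, 2 ≤ n → ∀ t, t < u n → 1 / (n : ℝ) ≤ T t)
    (hgt : ∀ n, 2 ≤ n → ∀ t, u n < t → T t < 1 / (n : ℝ)) {y : ℝ} (hy : 0 < y) :
    Tendsto (fun n : ℕ => n * T (w - (w - u n) * y)) atTop (𝓝 (y ^ α)) := by
  have ha : Tendsto (fun n => w - u n) atTop (𝓝[>] 0) := by
    have hev : ∀ᶠ n in atTop, w - u n ∈ Set.Ioi (0 : ℝ) := by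
      filter_upwards [eventually_ge_atTop 2] with n hn
      exact sub_pos.2 (hu n hn)
    refine tendsto_nhdsWithin_iff.2 ⟨tendsto_order.2 ⟨fun L hL => ?_, fun L hL => ?_⟩, hev⟩
    · filter_upwards [hev] with n hn using hL.trans hn
    · have h1 : 0 < T (w - L / 2) := hpos _ (by linarith)
      filter_upwards [eventually_ge_atTop 2,
        (tendsto_one_div_atTop_nhds_zero_nat (𝕜 := ℝ)).eventually (gt_mem_nhds h1)] with n hn hn'
      by_contra hcon
      exact absurd (hgt n hn (w - L / 2) (by linarith)) (not_lt.2 hn'.le)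
  have hrat : ∀ x : ℝ, 0 < x →
      Tendsto (fun n => T (w - x * (w - u n)) / T (w - (w - u n))) atTop (𝓝 (x ^ α)) :=
    fun x hx => (hR x hx).comp ha
  have hTpos : ∀ n, 2 ≤ n → 0 < T (w - (w - u n)) := fun n hn =>
    hpos _ (by linarith [hu n hn])
  have hcont : Tendsto (fun x : ℝ => (x ^ α)⁻¹) (𝓝 1) (𝓝 1) := by
    have : Tendsto (fun x : ℝ => x ^ α) (𝓝 1) (𝓝 (1 ^ α)) :=
      (Real.continuousAt_rpow_const 1 α (Or.inl one_ne_zero)).tendsto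
    simpa using this.inv₀ (by simp)
  -- It suffices to treat `y = 1`. There `n * T (u n)` is compared with
  -- `n * T (w - x * (w - u n))`, which is at least `1` for `x > 1` and below `1` for `x < 1`.
  have hone : Tendsto (fun n : ℕ => n * T (w - (w - u n))) atTop (𝓝 1) := by
    refine tendsto_order.2 ⟨fun L hL => ?_, fun L hL => ?_⟩
    · have h1 : ∀ᶠ x in 𝓝[>] (1 : ℝ), L < (x ^ α)⁻¹ ∧ 1 < x := by
        filter_upwards [nhdsWithin_le_nhds (hcont.eventually (lt_mem_nhds hL)),
          self_mem_nhdsWithin] with x h h' using ⟨h, h'⟩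
      obtain ⟨x, hx, hx1⟩ := h1.exists
      have hx0 : 0 < x := one_pos.trans hx1
      have h2 := (hrat x hx0).inv₀ (by positivity)
      filter_upwards [eventually_ge_atTop 2, h2.eventually (lt_mem_nhds hx)] with n hn hn'
      have hn0 : (0 : ℝ) < n := by positivity
      have h3 := hlt n hn (w - x * (w - u n)) (by
        linarith [mul_lt_mul_of_pos_right hx1 (sub_pos.2 (hu n hn))])
      rw [div_le_iff₀ hn0] at h3
      rw [inv_div] at hn'
      refine hn'.trans_le ?_
      have h4 : 0 < T (w - x * (w - u n)) := pos_of_mul_pos_left (one_pos.trans_le h3) hn0.le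
      rw [div_le_iff₀ h4]
      linarith [mul_le_mul_of_nonneg_left h3 (hTpos n hn).le]
    · have h1 : ∀ᶠ x in 𝓝[<] (1 : ℝ), (x ^ α)⁻¹ < L ∧ 0 < x ∧ x < 1 := by
        filter_upwards [nhdsWithin_le_nhds (hcont.eventually (gt_mem_nhds hL)),
          nhdsWithin_le_nhds (lt_mem_nhds (zero_lt_one' ℝ)),
          self_mem_nhdsWithin] with x h h' h'' using ⟨h, h', h''⟩
      obtain ⟨x, hx, hx0, hx1⟩ := h1.exists
      have h2 := (hrat x hx0).inv₀ (by positivity)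
      filter_upwards [eventually_ge_atTop 2, h2.eventually (gt_mem_nhds hx)] with n hn hn'
      have hn0 : (0 : ℝ) < n := by positivity
      have hd := sub_pos.2 (hu n hn)
      have h3 := hgt n hn (w - x * (w - u n)) (by linarith [mul_lt_mul_of_pos_right hx1 hd])
      rw [lt_div_iff₀ hn0] at h3
      rw [inv_div] at hn'
      refine lt_of_le_of_lt ?_ hn'
      have h4 : 0 < T (w - x * (w - u n)) := hpos _ (by linarith [mul_pos hx0 hd])
      rw [le_div_iff₀ h4]
      linarith [mul_le_mul_of_nonneg_left h3.le (hTpos n hn).le]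
  have hfin := (hrat y hy).mul hone
  rw [mul_one] at hfin
  refine hfin.congr' ?_
  filter_upwards [eventually_ge_atTop 2] with n hn
  have := (hTpos n hn).ne'
  rw [mul_comm (w - u n) y]
  field_simp

end Quantile

/-! ### The tail of a distribution function and its endpoint -/

section Cdf

variable (μ : Measure ℝ)

theorem tail_antitone : Antitone (tail (cdf μ)) := fun _ _ h =>
  sub_le_sub_left (monotone_cdf μ h) 1

theorem tail_nonneg (t : ℝ) : 0 ≤ tail (cdf μ) t := sub_nonneg.2 (cdf_le_one μ t)

theorem tendsto_tail_atBot : Tendsto (tail (cdf μ)) atBot (𝓝 1) := by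
  have := (tendsto_cdf_atBot μ).const_sub 1
  rwa [sub_zero] at this

variable {μ}

theorem bddBelow_tail_lt {n : ℕ} (hn : 2 ≤ n) :
    BddBelow {t : ℝ | tail (cdf μ) t < 1 / (n : ℝ)} := by
  have hn' : 1 / (n : ℝ) < 1 := by
    rw [div_lt_one (by positivity)]
    exact_mod_cast hn
  obtain ⟨s, hs⟩ := ((tendsto_tail_atBot μ).eventually (lt_mem_nhds hn')).exists
  refine ⟨s, fun t ht => not_lt.1 fun hts => ?_⟩
  exact absurd (tail_antitone μ hts.le) (not_le.2 (lt_trans ht hs))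

theorem le_tail_of_lt_tailQuantile {n : ℕ} (hn : 2 ≤ n) {t : ℝ} (ht : t < tailQuantile (cdf μ) n) :
    1 / (n : ℝ) ≤ tail (cdf μ) t :=
  not_lt.1 fun h => absurd (csInf_le (bddBelow_tail_lt hn) h) (not_le.2 ht)

/-- Regular variation rules out an atom at the endpoint, so that the quantiles stay below it. -/
theorem tailQuantile_lt {α : ℝ} (hα : 0 < α)
    (hR : RegVaryingAtZero (fun u => tail (cdf μ) ((upperEndpoint μ).toReal - u)) α)
    {n : ℕ} (hn : 2 ≤ n) : tailQuantile (cdf μ) n < (upperEndpoint μ).toReal := by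
  have h0 := hR.tendsto_zero hα (tail_antitone μ)
  have hn' : 0 < 1 / (n : ℝ) := by positivity
  obtain ⟨h, hh, hh0⟩ := ((h0.eventually (gt_mem_nhds hn')).and self_mem_nhdsWithin).exists
  refine (csInf_le (bddBelow_tail_lt hn) hh).trans_lt ?_
  linarith [show 0 < h from hh0]

variable (μ) [IsProbabilityMeasure μ]

theorem tail_eq_measureReal (t : ℝ) : tail (cdf μ) t = μ.real (Set.Ioi t) := by
  rw [tail, cdf_eq_real, ← Set.compl_Iic, probReal_compl_eq_one_sub measurableSet_Iic]

theorem upperEndpoint_le_iff (t : ℝ) : upperEndpoint μ ≤ t ↔ tail (cdf μ) t = 0 := by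
  rw [tail_eq_measureReal, measureReal_eq_zero_iff, upperEndpoint, sSup_le_iff]
  constructor
  · intro h
    refine measure_mono_null ?_ (Measure.measure_compl_support (μ := μ))
    intro x hx hxs
    have := h _ ⟨x, hxs, rfl⟩
    exact absurd hx (not_lt.2 (EReal.coe_le_coe_iff.1 this))
  · rintro h _ ⟨x, hx, rfl⟩
    refine EReal.coe_le_coe_iff.2 (not_lt.1 fun hlt => ?_)
    exact Measure.notMem_support_iff_exists.2 ⟨_, Ioi_mem_nhds hlt, h⟩ hx

theorem upperEndpoint_ne_bot : upperEndpoint μ ≠ ⊥ := by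
  intro h
  have h0 : ∀ t, tail (cdf μ) t = 0 := fun t => (upperEndpoint_le_iff μ t).1 (h ▸ bot_le)
  have := (tendsto_tail_atBot μ).congr h0
  exact zero_ne_one (tendsto_nhds_unique tendsto_const_nhds this)

variable {μ}

theorem tail_pos_of_lt (htop : upperEndpoint μ < ⊤) {t : ℝ} (ht : t < (upperEndpoint μ).toReal) :
    0 < tail (cdf μ) t := by
  refine lt_of_le_of_ne (tail_nonneg μ t) fun h0 => ?_
  have := (upperEndpoint_le_iff μ t).2 h0.symm
  rw [← EReal.coe_toReal htop.ne (upperEndpoint_ne_bot μ), EReal.coe_le_coe_iff] at this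
  exact absurd ht (not_lt.2 this)

theorem tail_eq_zero_of_le (htop : upperEndpoint μ < ⊤) {t : ℝ}
    (ht : (upperEndpoint μ).toReal ≤ t) : tail (cdf μ) t = 0 := by
  rw [← upperEndpoint_le_iff, ← EReal.coe_toReal htop.ne (upperEndpoint_ne_bot μ)]
  exact EReal.coe_le_coe_iff.2 ht

theorem tail_lt_of_tailQuantile_lt (htop : upperEndpoint μ < ⊤) {n : ℕ} (hn : 2 ≤ n) {t : ℝ}
    (ht : tailQuantile (cdf μ) n < t) : tail (cdf μ) t < 1 / (n : ℝ) := by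
  have hne : {t : ℝ | tail (cdf μ) t < 1 / (n : ℝ)}.Nonempty := by
    refine ⟨(upperEndpoint μ).toReal, ?_⟩
    rw [Set.mem_ofPred_eq, tail_eq_zero_of_le htop le_rfl]
    positivity
  obtain ⟨s, hs, hst⟩ := exists_lt_of_csInf_lt hne ht
  exact (tail_antitone μ hst.le).trans_lt hs

end Cdf

/-! ### From attraction to power behaviour of the tail -/

section Necessity

variable {μ : Measure ℝ}

theorem freeMaxPow_cdf (n : ℕ) (t : ℝ) :
    freeMaxPow (cdf μ) n t = max 0 (1 - n * tail (cdf μ) t) := by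
  rw [freeMaxPow_apply _ (cdf_le_one μ), tail]
  congr 1
  ring

theorem continuousAt_betaLaw {α c : ℝ} (hc : 0 < c) (hc1 : c < 1) :
    ContinuousAt (betaLaw α) (-c) := by
  have h : (fun x : ℝ => 1 - |x| ^ α) =ᶠ[𝓝 (-c)] betaLaw α := by
    filter_upwards [Ioo_mem_nhds (neg_lt_neg hc1) (neg_lt_zero.2 hc)] with x hx
    rw [betaLaw, if_neg (not_lt.2 hx.1.le), if_pos hx.2.le]
  refine ContinuousAt.congr ?_ h
  exact continuousAt_const.sub
    (continuous_abs.continuousAt.rpow_const (Or.inl (abs_ne_zero.2 (neg_ne_zero.2 hc.ne'))))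

theorem betaLaw_neg {α y : ℝ} (hα : 0 < α) (hy : 0 < y) :
    betaLaw α (-y) = max 0 (1 - y ^ α) := by
  rw [betaLaw, abs_neg, abs_of_pos hy]
  split_ifs with h1 h2
  · exact (max_eq_left (sub_nonpos.2 (Real.one_le_rpow (by linarith) hα.le))).symm
  · exact (max_eq_right (sub_nonneg.2 (Real.rpow_le_one hy.le (by linarith) hα.le))).symm
  · linarith

theorem FreeMaxLimit.hasPowerTail {α : ℝ} (hα : 0 < α) {a b : ℕ → ℝ}
    (h : FreeMaxLimit (cdf μ) (betaLaw α) a b) : HasPowerTail (tail (cdf μ)) α a b := by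
  intro c hc hc1
  have h1 := h (-c) (continuousAt_betaLaw hc hc1)
  have hcα : 0 < 1 - c ^ α := sub_pos.2 (Real.rpow_lt_one hc.le hc1 hα)
  rw [betaLaw_neg hα hc, max_eq_right hcα.le] at h1
  have h2 := h1.const_sub 1
  rw [sub_sub_cancel] at h2
  refine h2.congr' ?_
  -- The positive part is eventually inactive, as the limit `1 - c ^ α` is positive.
  filter_upwards [h1.eventually (lt_mem_nhds hcα)] with n hn
  have e : a n * -c + b n = b n - a n * c := by ring
  simp only [freeMaxPow_cdf, e] at hn ⊢
  rw [max_eq_right ((lt_max_iff.1 hn).resolve_left (lt_irrefl _)).le, sub_sub_cancel]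

theorem continuousAt_weibullLaw {α c : ℝ} (hc : 0 < c) : ContinuousAt (weibullLaw α) (-c) := by
  have h : (fun x : ℝ => Real.exp (-(-x) ^ α)) =ᶠ[𝓝 (-c)] weibullLaw α := by
    filter_upwards [gt_mem_nhds (neg_lt_zero.2 hc)] with x hx
    rw [weibullLaw, if_pos hx]
  refine ContinuousAt.congr ?_ h
  refine Real.continuous_exp.continuousAt.comp (ContinuousAt.neg ?_)
  exact continuous_neg.continuousAt.rpow_const (Or.inl (by simpa using hc.ne'))

/-- Converse of the limit `(1 - s / n) ^ n → exp (-s)`. -/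
theorem tendsto_mul_of_tendsto_one_sub_pow {p : ℕ → ℝ} (hp : ∀ n, p n ≤ 1) {s : ℝ}
    (h : Tendsto (fun n => (1 - p n) ^ n) atTop (𝓝 (Real.exp (-s)))) :
    Tendsto (fun n : ℕ => n * p n) atTop (𝓝 s) := by
  have hexp : ∀ L : ℝ, Tendsto (fun n : ℕ => (1 - L / n) ^ n) atTop (𝓝 (Real.exp (-L))) := by
    intro L
    refine (Real.tendsto_one_add_div_pow_exp (-L)).congr fun n => ?_
    rw [neg_div, sub_eq_add_neg]
  refine tendsto_order.2 ⟨fun L hL => ?_, fun L hL => ?_⟩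
  · filter_upwards [h.eventually_lt (hexp L) (Real.exp_lt_exp.2 (neg_lt_neg hL)),
      eventually_gt_atTop 0, tendsto_natCast_atTop_atTop.eventually (eventually_gt_atTop L)]
      with n hn hn0 hLn
    by_contra hcon
    have hn0' : (0 : ℝ) < n := by positivity
    have h1 : p n ≤ L / n := by
      rw [le_div_iff₀ hn0']; linarith
    have h2 : L / n ≤ 1 := (div_le_one hn0').2 hLn.le
    exact absurd (pow_le_pow_left₀ (sub_nonneg.2 h2) (sub_le_sub_left h1 1) n) (not_le.2 hn)
  · filter_upwards [(hexp L).eventually_lt h (Real.exp_lt_exp.2 (neg_lt_neg hL)),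
      eventually_gt_atTop 0] with n hn hn0
    by_contra hcon
    have hn0' : (0 : ℝ) < n := by positivity
    have h1 : L / n ≤ p n := by
      rw [div_le_iff₀ hn0']; linarith
    exact absurd (pow_le_pow_left₀ (by linarith [hp n]) (by linarith : 1 - p n ≤ 1 - L / n) n)
      (not_le.2 hn)

theorem ClassicalMaxLimit.hasPowerTail {α : ℝ} {a b : ℕ → ℝ}
    (h : ClassicalMaxLimit (cdf μ) (weibullLaw α) a b) : HasPowerTail (tail (cdf μ)) α a b := by
  intro c hc hc1
  have h1 := h (-c) (continuousAt_weibullLaw hc)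
  rw [weibullLaw, if_pos (neg_lt_zero.2 hc), neg_neg] at h1
  refine tendsto_mul_of_tendsto_one_sub_pow
    (fun n => sub_le_self _ (cdf_nonneg μ _)) (h1.congr fun n => ?_)
  have e : a n * -c + b n = b n - a n * c := by ring
  simp only [e, sub_sub_cancel]

end Necessity

/-! ### From regular variation to attraction -/

section Sufficiency

variable {μ : Measure ℝ} [IsProbabilityMeasure μ] {α : ℝ} {a : ℕ → ℝ}

theorem freeMaxLimit_of_tail (hα : 0 < α) (htop : upperEndpoint μ < ⊤)
    (ha : ∀ᶠ n in atTop, 0 < a n)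
    (h : ∀ y : ℝ, 0 < y → Tendsto
      (fun n : ℕ => n * tail (cdf μ) ((upperEndpoint μ).toReal - a n * y)) atTop (𝓝 (y ^ α))) :
    FreeMaxLimit (cdf μ) (betaLaw α) a (fun _ => (upperEndpoint μ).toReal) := by
  intro x _
  simp only [freeMaxPow_cdf]
  rcases lt_or_ge x 0 with hx | hx
  · have h1 := ((h (-x) (neg_pos.2 hx)).const_sub 1).max (tendsto_const_nhds (x := (0 : ℝ)))
    rw [max_comm, ← betaLaw_neg hα (neg_pos.2 hx), neg_neg] at h1
    refine h1.congr fun n => ?_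
    rw [max_comm, mul_neg, sub_neg_eq_add, add_comm (a n * x)]
  · have hx1 : betaLaw α x = 1 := by
      rw [betaLaw, if_neg (by linarith)]
      split_ifs with h0
      · rw [le_antisymm h0 hx, abs_zero, Real.zero_rpow hα.ne', sub_zero]
      · rfl
    rw [hx1]
    refine tendsto_const_nhds.congr' ?_
    filter_upwards [ha] with n hn
    rw [tail_eq_zero_of_le htop (by linarith [mul_nonneg hn.le hx])]
    simp

theorem classicalMaxLimit_of_tail (htop : upperEndpoint μ < ⊤)
    (ha : ∀ᶠ n in atTop, 0 < a n)
    (h : ∀ y : ℝ, 0 < y → Tendsto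
      (fun n : ℕ => n * tail (cdf μ) ((upperEndpoint μ).toReal - a n * y)) atTop (𝓝 (y ^ α))) :
    ClassicalMaxLimit (cdf μ) (weibullLaw α) a (fun _ => (upperEndpoint μ).toReal) := by
  intro x _
  rcases lt_or_ge x 0 with hx | hx
  · rw [weibullLaw, if_pos hx]
    have h1 := (h (-x) (neg_pos.2 hx)).neg
    simp only [← mul_neg] at h1
    refine (Real.tendsto_one_add_pow_exp_of_tendsto h1).congr fun n => ?_
    rw [mul_neg, sub_neg_eq_add, add_comm _ (a n * x), tail]
    congr 1
    ring
  · rw [weibullLaw, if_neg (not_lt.2 hx)]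
    refine tendsto_const_nhds.congr' ?_
    filter_upwards [ha] with n hn
    have h0 : tail (cdf μ) (a n * x + (upperEndpoint μ).toReal) = 0 :=
      tail_eq_zero_of_le htop (by linarith [mul_nonneg hn.le hx])
    rw [show cdf μ (a n * x + (upperEndpoint μ).toReal) = 1 from (sub_eq_zero.1 h0).symm, one_pow]

/-- Regular variation gives both limits for all scalings that agree eventually with the distance
of the quantiles to the endpoint. -/
theorem limits_of_regVarying (hα : 0 < α) (htop : upperEndpoint μ < ⊤)
    (hR : RegVaryingAtZero (fun u => tail (cdf μ) ((upperEndpoint μ).toReal - u)) α)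
    (ha : ∀ n, 2 ≤ n → a n = (upperEndpoint μ).toReal - tailQuantile (cdf μ) n) :
    FreeMaxLimit (cdf μ) (betaLaw α) a (fun _ => (upperEndpoint μ).toReal) ∧
      ClassicalMaxLimit (cdf μ) (weibullLaw α) a (fun _ => (upperEndpoint μ).toReal) := by
  have hpos : ∀ᶠ n in atTop, 0 < a n := by
    filter_upwards [eventually_ge_atTop 2] with n hn
    rw [ha n hn]
    exact sub_pos.2 (tailQuantile_lt hα hR hn)
  have h : ∀ y : ℝ, 0 < y → Tendsto
      (fun n : ℕ => n * tail (cdf μ) ((upperEndpoint μ).toReal - a n * y)) atTop (𝓝 (y ^ α)) := by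
    intro y hy
    refine (tendsto_mul_tail_quantile (fun t => tail_pos_of_lt htop) hR
      (fun n => tailQuantile_lt hα hR) (fun n hn t => le_tail_of_lt_tailQuantile hn)
      (fun n hn t => tail_lt_of_tailQuantile_lt htop hn) hy).congr' ?_
    filter_upwards [eventually_ge_atTop 2] with n hn
    rw [ha n hn]
  exact ⟨freeMaxLimit_of_tail hα htop hpos h, classicalMaxLimit_of_tail htop hpos h⟩

end Sufficiency

end FreeExtreme

theorem theorem6p13 (μ : MeasureTheory.Measure ℝ) [MeasureTheory.IsProbabilityMeasure μ]
    (α : ℝ) (hα : 0 < α) :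
    [ InFreeMaxDomain (ProbabilityTheory.cdf μ) (betaLaw α),
      InClassicalMaxDomain (ProbabilityTheory.cdf μ) (weibullLaw α),
      upperEndpoint μ < ⊤ ∧
        RegVaryingAtZero
          (fun u => tail (ProbabilityTheory.cdf μ) ((upperEndpoint μ).toReal - u)) α ].TFAE ∧
    (InFreeMaxDomain (ProbabilityTheory.cdf μ) (betaLaw α) →
      (∀ n : ℕ, 2 ≤ n →
        0 < (upperEndpoint μ).toReal - tailQuantile (ProbabilityTheory.cdf μ) n) ∧
      FreeMaxLimit (ProbabilityTheory.cdf μ) (betaLaw α)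
        (fun n => (upperEndpoint μ).toReal - tailQuantile (ProbabilityTheory.cdf μ) n)
        (fun _ => (upperEndpoint μ).toReal) ∧
      ClassicalMaxLimit (ProbabilityTheory.cdf μ) (weibullLaw α)
        (fun n => (upperEndpoint μ).toReal - tailQuantile (ProbabilityTheory.cdf μ) n)
        (fun _ => (upperEndpoint μ).toReal)) := by
  have h13 : InFreeMaxDomain (cdf μ) (betaLaw α) → upperEndpoint μ < ⊤ ∧
      RegVaryingAtZero (fun u => tail (cdf μ) ((upperEndpoint μ).toReal - u)) α := by
    rintro ⟨a, b, ha, h⟩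
    exact (h.hasPowerTail hα).endpoint_regVarying (tail_antitone μ) (tail_nonneg μ) hα ha _
      (upperEndpoint_le_iff μ)
  have h23 : InClassicalMaxDomain (cdf μ) (weibullLaw α) → upperEndpoint μ < ⊤ ∧
      RegVaryingAtZero (fun u => tail (cdf μ) ((upperEndpoint μ).toReal - u)) α := by
    rintro ⟨a, b, ha, h⟩
    exact h.hasPowerTail.endpoint_regVarying (tail_antitone μ) (tail_nonneg μ) hα ha _
      (upperEndpoint_le_iff μ)
  have h3 : (upperEndpoint μ < ⊤ ∧
      RegVaryingAtZero (fun u => tail (cdf μ) ((upperEndpoint μ).toReal - u)) α) →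
      InFreeMaxDomain (cdf μ) (betaLaw α) ∧ InClassicalMaxDomain (cdf μ) (weibullLaw α) := by
    rintro ⟨htop, hR⟩
    -- For `n < 2` the quantile need not lie below the endpoint; the scaling there is irrelevant.
    set a : ℕ → ℝ := fun n =>
      if 2 ≤ n then (upperEndpoint μ).toReal - tailQuantile (cdf μ) n else 1 with ha_def
    have ha : ∀ n, 0 < a n := by
      intro n
      simp only [ha_def]
      split_ifs with hn
      · exact sub_pos.2 (tailQuantile_lt hα hR hn)
      · exact one_pos
    obtain ⟨h1, h2⟩ := limits_of_regVarying hα htop hR (a := a) fun n hn => if_pos hn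
    exact ⟨⟨a, _, ha, h1⟩, ⟨a, _, ha, h2⟩⟩
  refine ⟨?_, fun h => ?_⟩
  · tfae_have 1 → 3 := h13
    tfae_have 2 → 3 := h23
    tfae_have 3 → 1 := fun h => (h3 h).1
    tfae_have 3 → 2 := fun h => (h3 h).2
    tfae_finish
  · obtain ⟨htop, hR⟩ := h13 h
    exact ⟨fun n hn => sub_pos.2 (tailQuantile_lt hα hR hn),
      limits_of_regVarying hα htop hR fun n _ => rfl⟩
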